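/- Write a permutation $p\in S_n$ in one-line notation $p=p_1p_2\cdots p_n$. Say that $p$ avoids $123$ if there are no indices $i<j<k$ with $p_i<p_j<p_k$. Call $p$ (skew-)decomposable if there is an integer $k$ with $1\le k<n$ such that $p_i>p_j$ for all $i\le k$ and all $j>k$, and (skew-)indecomposable otherwise. Let $\mathrm{Av}_n^*(123)$ be the set of indecomposable permutations in $S_n$ that avoid $123$, and let $c_m=\frac{1}{m+1}\binom{2m}{m}$ denote the $m$th Catalan number. Proposition. For all $n\ge 1$, $$|\mathrm{Av}_n^*(123)|=\frac1n\binom{2n-2}{n-1}=c_{n-1}.$$ -/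

import Mathlib

namespace PermPattern

/-- The permutation `p` of length `n` contains `q` of length `k` as a pattern: there are positions
`f 0 < f 1 < ⋯ < f (k - 1)` at which the entries of `p` are in the same relative order as the
entries of `q`. Permutations are in one-line notation `p 0, p 1, …, p (n - 1)`, 0-indexed. -/
def Contains {n k : ℕ} (p : Equiv.Perm (Fin n)) (q : Equiv.Perm (Fin k)) : Prop :=
  ∃ f : Fin k ↪o Fin n, ∀ a b : Fin k, q a < q b ↔ p (f a) < p (f b)

/-- `p` avoids `q`. -/
def Avoids {n k : ℕ} (p : Equiv.Perm (Fin n)) (q : Equiv.Perm (Fin k)) : Prop :=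
  ¬ Contains p q

/-- The pattern `123`, i.e. the identity permutation of length three. -/
def pattern123 : Equiv.Perm (Fin 3) := 1

/-- `p` is (skew-)decomposable: for some `1 ≤ k < n`, each of the first `k` entries of `p` is larger
than each of the remaining `n - k` entries. -/
def Decomposable {n : ℕ} (p : Equiv.Perm (Fin n)) : Prop :=
  ∃ k : ℕ, 1 ≤ k ∧ k < n ∧ ∀ i j : Fin n, (i : ℕ) < k → k ≤ (j : ℕ) → p j < p i

/-- `p` is (skew-)indecomposable. -/
def Indecomposable {n : ℕ} (p : Equiv.Perm (Fin n)) : Prop :=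
  ¬ Decomposable p

/-- The set of permutations of length `n` avoiding `q`. -/
def Av {k : ℕ} (q : Equiv.Perm (Fin k)) (n : ℕ) : Set (Equiv.Perm (Fin n)) :=
  {p | Avoids p q}

/-- The set of indecomposable permutations of length `n` avoiding `q`. -/
def AvStar {k : ℕ} (q : Equiv.Perm (Fin k)) (n : ℕ) : Set (Equiv.Perm (Fin n)) :=
  {p | p ∈ Av q n ∧ Indecomposable p}

end PermPattern

/-! A `123`-avoiding permutation is determined by its running minimum: an entry that is not a
left-to-right minimum cannot be followed by a larger one, so the other entries decrease
(`runMin_injOn`). In length `n + 1`, indecomposability keeps the running minimum below a staircase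
(`indecomposable_iff_runMin_le`), and every antitone sequence below it occurs
(`exists_runMin_eq_of_antitone`). These sequences satisfy the ballot recursion in a bound `c` on
their terms, giving `C(n+c, n) - C(n+c, n+1)`, which is Catalan at `c = n`. -/

namespace PermPattern

open Finset

/-! ### Counting antitone sequences below a staircase -/

/-- Antitone sequences of length `n + 1` bounded by `c` and lying below the staircase
`n - 1, n - 2, …, 0, 0`. -/
def staircaseSeq (n c : ℕ) : Set (Fin (n + 1) → ℕ) :=
  {m | Antitone m ∧ ∀ i : Fin (n + 1), m i ≤ n - 1 - (i : ℕ) ∧ m i ≤ c}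

lemma staircaseSeq_zero_right (n : ℕ) : staircaseSeq n 0 = {fun _ => 0} := by
  ext m
  simp only [staircaseSeq, Set.mem_ofPred_eq, Set.mem_singleton_iff]
  constructor
  · rintro ⟨_, h⟩
    funext i
    have := (h i).2
    omega
  · rintro rfl
    exact ⟨antitone_const, fun i => ⟨Nat.zero_le _, le_rfl⟩⟩

lemma staircaseSeq_succ_self (n : ℕ) :
    staircaseSeq (n + 1) (n + 1) = staircaseSeq (n + 1) n := by
  ext m
  simp only [staircaseSeq, Set.mem_ofPred_eq]
  refine and_congr_right fun _ => forall_congr' fun i => ?_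
  omega

lemma antitone_cons {n a : ℕ} {m : Fin (n + 1) → ℕ} (hm : Antitone m) (h : ∀ i, m i ≤ a) :
    Antitone (Fin.cons a m : Fin (n + 2) → ℕ) := by
  intro i j hij
  induction j using Fin.cases with
  | zero =>
    obtain rfl : i = 0 := Fin.le_zero_iff.mp hij
    exact le_rfl
  | succ j =>
    induction i using Fin.cases with
    | zero => simpa using h j
    | succ i => simpa using hm (Fin.succ_le_succ_iff.mp hij)

/-- Split on whether the first term attains `c + 1`; deleting it shifts the staircase by one step.
`hc` makes `c + 1` fit under the first step. -/
lemma staircaseSeq_succ_succ {n c : ℕ} (hc : c + 1 ≤ n) :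
    staircaseSeq (n + 1) (c + 1) =
      staircaseSeq (n + 1) c ∪
        (fun m => (Fin.cons (c + 1) m : Fin (n + 2) → ℕ)) '' staircaseSeq n (c + 1) := by
  ext m
  simp only [staircaseSeq, Set.mem_union, Set.mem_ofPred_eq, Set.mem_image]
  constructor
  · rintro ⟨hm, h⟩
    by_cases h0 : m 0 ≤ c
    · exact Or.inl ⟨hm, fun i => ⟨(h i).1, (hm (Fin.zero_le i)).trans h0⟩⟩
    · have h0' : m 0 = c + 1 := by have := (h 0).2; omega
      refine Or.inr ⟨Fin.tail m, ⟨fun i j hij => hm (Fin.succ_le_succ_iff.mpr hij),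
        fun i => ⟨?_, (h i.succ).2⟩⟩, ?_⟩
      · have := (h i.succ).1
        simp only [Fin.val_succ] at this
        simp only [Fin.tail]
        omega
      · rw [← h0']
        exact Fin.cons_self_tail m
  · rintro (⟨hm, h⟩ | ⟨m, ⟨hm, h⟩, rfl⟩)
    · exact ⟨hm, fun i => ⟨(h i).1, (h i).2.trans (Nat.le_succ c)⟩⟩
    · refine ⟨antitone_cons hm fun i => (h i).2, fun i => ?_⟩
      induction i using Fin.cases with
      | zero => simp only [Fin.cons_zero, Fin.val_zero]; omega
      | succ i =>
        have := h i
        simp only [Fin.cons_succ, Fin.val_succ]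
        omega

lemma encard_staircaseSeq_succ_succ {n c : ℕ} (hc : c + 1 ≤ n) :
    (staircaseSeq (n + 1) (c + 1)).encard =
      (staircaseSeq (n + 1) c).encard + (staircaseSeq n (c + 1)).encard := by
  rw [staircaseSeq_succ_succ hc, Set.encard_union_eq, Function.Injective.encard_image]
  · exact Fin.cons_right_injective (α := fun _ => ℕ) (c + 1)
  · rw [Set.disjoint_left]
    rintro _ ⟨_, h⟩ ⟨m, _, rfl⟩
    have := (h 0).2
    simp at this

/-- The ballot numbers count the staircase sequences. -/
lemma exists_encard_staircaseSeq (n : ℕ) : ∀ c ≤ n, ∃ a : ℕ,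
    (staircaseSeq n c).encard = a ∧ a + (n + c).choose (n + 1) = (n + c).choose n := by
  have base (n : ℕ) : ∃ a : ℕ, (staircaseSeq n 0).encard = a ∧
      a + (n + 0).choose (n + 1) = (n + 0).choose n :=
    ⟨1, by rw [staircaseSeq_zero_right]; simp, by simp⟩
  induction n with
  | zero =>
    intro c hc
    obtain rfl : c = 0 := by omega
    exact base 0
  | succ n ih =>
    intro c
    induction c with
    | zero => exact fun _ => base _
    | succ c ihc =>
      intro hc
      obtain ⟨a, ha, ha'⟩ := ihc (by omega)
      have e : n + 1 + (c + 1) = (n + 1 + c) + 1 := by omega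
      rcases Nat.lt_or_ge n (c + 1) with h | h
      · obtain rfl : c = n := by omega
        refine ⟨a, by rw [staircaseSeq_succ_self, ha], ?_⟩
        have hs : (c + 1 + c).choose c = (c + 1 + c).choose (c + 1) :=
          Nat.choose_symm_of_eq_add (by omega)
        rw [e, Nat.choose_succ_succ', Nat.choose_succ_succ']
        omega
      · obtain ⟨b, hb, hb'⟩ := ih (c + 1) h
        refine ⟨a + b, by rw [encard_staircaseSeq_succ_succ h, ha, hb]; push_cast; rfl, ?_⟩
        have e' : n + (c + 1) = n + 1 + c := by omega
        rw [e'] at hb'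
        rw [e, Nat.choose_succ_succ', Nat.choose_succ_succ']
        omega

lemma ncard_staircaseSeq_self (n : ℕ) : (staircaseSeq n n).ncard = catalan n := by
  obtain ⟨a, ha, h⟩ := exists_encard_staircaseSeq n n le_rfl
  have hn : (staircaseSeq n n).ncard = a := by simp [Set.ncard, ha]
  rw [hn]
  have h1 := Nat.choose_succ_right_eq (n + n) n
  have h2 := succ_mul_catalan_eq_centralBinom n
  rw [Nat.centralBinom_eq_two_mul_choose, two_mul] at h2
  rw [Nat.add_sub_cancel] at h1
  refine Nat.eq_of_mul_eq_mul_left (Nat.succ_pos n) ?_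
  rw [Nat.succ_eq_add_one, h2]
  have h3 := congrArg (· * (n + 1)) h
  simp only [add_mul, h1] at h3
  linarith

/-! ### Entries of permutations of `Fin n` -/

lemma card_filter_le_perm {n : ℕ} (p : Equiv.Perm (Fin n)) (v : ℕ) :
    #{j | v ≤ (p j : ℕ)} = n - v := by
  have h : #{j | v ≤ (p j : ℕ)} = #{j : Fin n | v ≤ (j : ℕ)} :=
    Finset.card_bij (fun j _ => p j) (by simp) (by simp)
      (fun b hb => ⟨p.symm b, by simpa using hb, by simp⟩)
  rw [h, ← Finset.card_map Fin.valEmbedding]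
  have : (Finset.map Fin.valEmbedding {j : Fin n | v ≤ (j : ℕ)}) = Finset.Ico v n := by
    ext x
    simp only [mem_map, mem_filter, mem_univ, true_and, Fin.valEmbedding_apply, mem_Ico]
    exact ⟨by rintro ⟨a, h, rfl⟩; exact ⟨h, a.2⟩, fun h => ⟨⟨x, h.2⟩, h.1, rfl⟩⟩
  rw [this, Nat.card_Ico]

lemma mem_Av_pattern123_iff {n : ℕ} {p : Equiv.Perm (Fin n)} :
    p ∈ Av pattern123 n ↔ ∀ i j k : Fin n, i < j → j < k → p i < p j → ¬ p j < p k := by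
  constructor
  · intro h i j k hij hjk h1 h2
    refine h ⟨OrderEmbedding.ofStrictMono ![i, j, k] ?_, ?_⟩
    · rw [Fin.strictMono_iff_lt_succ]
      intro a
      fin_cases a
      · exact hij
      · exact hjk
    · have hs : StrictMono (p ∘ ![i, j, k]) := by
        rw [Fin.strictMono_iff_lt_succ]
        intro a
        fin_cases a
        · exact h1
        · exact h2
      exact fun a b => hs.lt_iff_lt.symm
  · rintro h ⟨f, hf⟩
    exact h (f 0) (f 1) (f 2) (f.strictMono (by decide)) (f.strictMono (by decide))
      ((hf 0 1).mp (by decide)) ((hf 1 2).mp (by decide))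

/-! ### Running minima -/

/-- The smallest among the entries of `p` up to position `i`. -/
def runMin {n : ℕ} (p : Equiv.Perm (Fin n)) (i : Fin n) : ℕ :=
  (Iic i).inf' ⟨i, mem_Iic.mpr le_rfl⟩ fun j => (p j : ℕ)

/-- `i` is a record of `m` if `m i` is smaller than every earlier term. -/
def IsRecord {n : ℕ} (m : Fin n → ℕ) (i : Fin n) : Prop := ∀ j < i, m i < m j

section

variable {n : ℕ} {p q : Equiv.Perm (Fin n)} {m : Fin n → ℕ} {i j : Fin n}

lemma runMin_le (h : j ≤ i) : runMin p i ≤ p j :=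
  Finset.inf'_le (fun j => (p j : ℕ)) (mem_Iic.mpr h)

lemma exists_runMin_eq (p : Equiv.Perm (Fin n)) (i : Fin n) :
    ∃ j ≤ i, runMin p i = p j := by
  obtain ⟨j, hj, h⟩ := Finset.exists_mem_eq_inf' ⟨i, mem_Iic.mpr (le_refl i)⟩
    fun j => (p j : ℕ)
  exact ⟨j, mem_Iic.mp hj, h⟩

lemma le_runMin {v : ℕ} (h : ∀ j ≤ i, v ≤ p j) : v ≤ runMin p i := by
  obtain ⟨j, hj, e⟩ := exists_runMin_eq p i
  exact e ▸ h j hj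

lemma antitone_runMin (p : Equiv.Perm (Fin n)) : Antitone (runMin p) :=
  fun _ _ h => le_runMin fun _ hk => runMin_le (hk.trans h)

lemma IsRecord.runMin_eq (h : IsRecord (runMin p) i) : runMin p i = p i := by
  obtain ⟨j, hj, e⟩ := exists_runMin_eq p i
  rcases hj.lt_or_eq with hj | rfl
  · have := h j hj
    have := runMin_le (p := p) (le_refl j)
    omega
  · exact e

lemma runMin_lt_of_not_isRecord (h : ¬ IsRecord (runMin p) i) : runMin p i < p i := by
  simp only [IsRecord, not_forall, not_lt] at h
  obtain ⟨j, hj, h⟩ := h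
  obtain ⟨k, hk, e⟩ := exists_runMin_eq p j
  have h1 := runMin_le (p := p) (le_refl i)
  have h2 := antitone_runMin p hj.le
  refine lt_of_le_of_ne h1 fun h3 => ?_
  have : p k = p i := Fin.ext (by omega)
  exact ((p.injective this) ▸ hk.trans_lt hj).false

/-- Away from the records of its running minimum, a `123`-avoiding permutation decreases. -/
lemma lt_of_not_isRecord (hp : p ∈ Av pattern123 n) (hi : ¬ IsRecord (runMin p) i)
    (hij : i < j) : p j < p i := by
  obtain ⟨k, hk, e⟩ := exists_runMin_eq p i
  have h1 := runMin_lt_of_not_isRecord hi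
  have hki : p k < p i := Fin.lt_def.mpr (by omega)
  have hk' : k < i := lt_of_le_of_ne hk (by rintro rfl; exact hki.false)
  have := mem_Av_pattern123_iff.mp hp k i j hk' hij hki
  exact lt_of_le_of_ne (not_lt.mp this) fun h => hij.ne' (p.injective h)

/-- Records fix their own entries. The remaining entries decrease and have the same set of values,
and a strictly monotone map is determined by its range. -/
lemma runMin_injOn : Set.InjOn (runMin (n := n)) (Av pattern123 n) := by
  intro p hp q hq h
  have hrec (i) (hi : IsRecord (runMin p) i) : p i = q i :=
    Fin.ext (by rw [← hi.runMin_eq, h, (h ▸ hi : IsRecord (runMin q) i).runMin_eq])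
  let A := {i // ¬ IsRecord (runMin p) i}
  have hp' : StrictMono fun i : A => OrderDual.toDual (p i) :=
    fun i j hij => OrderDual.toDual_lt_toDual.mpr (lt_of_not_isRecord hp i.2 hij)
  have hq' : StrictMono fun i : A => OrderDual.toDual (q i) :=
    fun i j hij => OrderDual.toDual_lt_toDual.mpr (lt_of_not_isRecord hq (h ▸ i.2) hij)
  have key := (StrictMono.range_inj hp' hq').mp (by
    ext v
    simp only [Set.mem_range]
    constructor
    · rintro ⟨i, rfl⟩
      refine ⟨⟨q.symm (p i), fun hr => ?_⟩, by simp⟩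
      have := hrec _ hr
      rw [Equiv.apply_symm_apply, p.injective.eq_iff] at this
      exact i.2 (this ▸ hr)
    · rintro ⟨i, rfl⟩
      refine ⟨⟨p.symm (q i), fun hr => ?_⟩, by simp⟩
      have := hrec _ hr
      rw [Equiv.apply_symm_apply, q.injective.eq_iff] at this
      exact i.2 (this ▸ hr))
  ext i : 1
  by_cases hi : IsRecord (runMin p) i
  · exact hrec i hi
  · exact OrderDual.toDual.injective (congrFun key ⟨i, hi⟩)

/-! ### The permutation with prescribed running minimum -/

lemma exists_isRecord_eq (hm : Antitone m) (i : Fin n) :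
    ∃ j ≤ i, IsRecord m j ∧ m j = m i := by
  induction i using WellFoundedLT.induction with
  | ind i ih =>
    by_cases hi : IsRecord m i
    · exact ⟨i, le_rfl, hi, rfl⟩
    · simp only [IsRecord, not_forall, not_lt] at hi
      obtain ⟨j, hj, h⟩ := hi
      obtain ⟨k, hk, hr, e⟩ := ih j hj
      exact ⟨k, hk.trans hj.le, hr, e.trans (h.antisymm (hm hj.le))⟩

lemma injOn_isRecord (m : Fin n → ℕ) : Set.InjOn m {i | IsRecord m i} := by
  intro i hi j hj h
  rcases lt_trichotomy i j with hij | hij | hij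
  · exact absurd h (hj i hij).ne'
  · exact hij
  · exact absurd h (hi j hij).ne

/-- Record values are distinct, so as many positions as values are left over; match these in reverse
order. -/
lemma exists_perm_isRecord (hlt : ∀ i, m i < n) :
    ∃ p : Equiv.Perm (Fin n), (∀ i, IsRecord m i → (p i : ℕ) = m i) ∧
      ∀ i j, ¬ IsRecord m i → ¬ IsRecord m j → i < j → p j < p i := by
  classical
  let r : {i // IsRecord m i} → Fin n := fun i => ⟨m i, hlt i⟩
  have hr : Function.Injective r := fun i j h =>
    Subtype.ext (injOn_isRecord m i.2 j.2 (Fin.mk.inj_iff.mp h))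
  let e : {i // IsRecord m i} ≃ {v // v ∈ Set.range r} := Equiv.ofInjective r hr
  have hc : Fintype.card {i // ¬ IsRecord m i} = Fintype.card {v // v ∉ Set.range r} :=
    Fintype.card_compl_eq_card_compl _ _ (Fintype.card_congr e)
  let f : {i // ¬ IsRecord m i} ≃o {v // v ∉ Set.range r}ᵒᵈ :=
    (Fintype.orderIsoFinOfCardEq _ hc).symm.trans (Fintype.orderIsoFinOfCardEq _ rfl)
  let f' : {i // ¬ IsRecord m i} ≃ {v // v ∉ Set.range r} := f.toEquiv.trans OrderDual.ofDual
  refine ⟨Equiv.subtypeCongr e f', fun i hi => ?_, fun i j hi hj hij => ?_⟩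
  · simp [Equiv.subtypeCongr, hi, e, r]
  · have h := f.strictMono (show (⟨i, hi⟩ : {i // ¬ IsRecord m i}) < ⟨j, hj⟩ from hij)
    have h' : f' ⟨j, hj⟩ < f' ⟨i, hi⟩ := h
    simpa [Equiv.subtypeCongr, hi, hj] using h'

end

/-- Every antitone sequence below the staircase is the running minimum of a `123`-avoiding
permutation. -/
lemma exists_runMin_eq_of_antitone {n : ℕ} {m : Fin n → ℕ} (hm : Antitone m)
    (hlt : ∀ i : Fin n, m i + i < n) : ∃ p ∈ Av pattern123 n, runMin p = m := by
  obtain ⟨p, hrec, hanti⟩ := exists_perm_isRecord (m := m) fun i => by have := hlt i; omega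
  have hge (i : Fin n) : m i ≤ p i := by
    by_cases hi : IsRecord m i
    · exact (hrec i hi).ge
    by_contra! hlt'
    -- If `p i < m i`, every entry from `i` on is below `m i`, so the `n - m i` values at least `m
    -- i` must fit in `i` positions.
    have hsub : ({j | m i ≤ (p j : ℕ)} : Finset (Fin n)) ⊆ Iio i := by
      intro j hj
      simp only [mem_filter, mem_univ, true_and] at hj
      rw [mem_Iio]
      by_contra! hij
      by_cases hjr : IsRecord m j
      · have hne : i ≠ j := by rintro rfl; exact hi hjr
        have := hjr i (lt_of_le_of_ne hij hne)
        have := hrec j hjr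
        omega
      · rcases hij.lt_or_eq with hij | rfl
        · have := Fin.lt_def.mp (hanti i j hi hjr hij)
          omega
        · omega
    have := Finset.card_le_card hsub
    rw [card_filter_le_perm, Fin.card_Iio] at this
    have := hlt i
    omega
  refine ⟨p, ?_, ?_⟩
  · rw [mem_Av_pattern123_iff]
    intro i j k hij hjk h1 h2
    have hrr (a b : Fin n) (hb : IsRecord m b) (ha : IsRecord m a) (hab : a < b) :
        p b < p a := by
      rw [Fin.lt_def, hrec a ha, hrec b hb]
      exact hb a hab
    -- By pigeonhole two of the three positions are both records or both non-records, and each class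
    -- decreases.
    by_cases hi : IsRecord m i <;> by_cases hj : IsRecord m j <;> by_cases hk : IsRecord m k
    all_goals first
      | exact (hrr i j hj hi hij).asymm h1
      | exact (hrr j k hk hj hjk).asymm h2
      | exact (hrr i k hk hi (hij.trans hjk)).asymm (h1.trans h2)
      | exact (hanti i j hi hj hij).asymm h1
      | exact (hanti j k hj hk hjk).asymm h2
      | exact (hanti i k hi hk (hij.trans hjk)).asymm (h1.trans h2)
  · funext i
    refine le_antisymm ?_ (le_runMin fun j hj => (hm hj).trans (hge j))
    obtain ⟨j, hj, hr, e⟩ := exists_isRecord_eq hm i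
    rw [← e, ← hrec j hr]
    exact runMin_le hj

/-! ### Indecomposability in terms of the running minimum -/

/-- A cut after position `i < n` means that the first `i + 1` entries are the largest ones, i.e.
their minimum is at least `n - i`. At `i = n` truncated subtraction gives the bound `0`, which
always holds. -/
lemma indecomposable_iff_runMin_le {n : ℕ} (p : Equiv.Perm (Fin (n + 1))) :
    Indecomposable p ↔ ∀ i : Fin (n + 1), runMin p i ≤ n - 1 - (i : ℕ) := by
  constructor
  · intro h i
    by_contra! hi
    rcases (Nat.lt_succ_iff.mp i.2).lt_or_eq with hin | hin
    · refine h ⟨i + 1, by omega, by omega, fun a b ha hb => ?_⟩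
      have ha' : a ≤ i := Fin.le_def.mpr (by omega)
      have hb' : i < b := Fin.lt_def.mpr (by omega)
      by_contra! hab
      -- Otherwise `i + 2` entries would be at least `runMin p i`, but only `i + 1` values are
      -- available.
      have hsub : insert b (Iic i) ⊆
          ({j | runMin p i ≤ (p j : ℕ)} : Finset (Fin (n + 1))) := by
        intro j hj
        rw [mem_insert, mem_Iic] at hj
        simp only [mem_filter, mem_univ, true_and]
        rcases hj with rfl | hj
        · exact (runMin_le ha').trans (Fin.le_def.mp hab)
        · exact runMin_le hj
      have := Finset.card_le_card hsub
      rw [card_filter_le_perm, card_insert_of_notMem (by simpa using hb'), Fin.card_Iic] at this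
      omega
    · have h0 : runMin p i ≤ p (p.symm 0) :=
        runMin_le (Fin.le_def.mpr (by have := (p.symm 0).2; omega))
      simp only [Equiv.apply_symm_apply, Fin.val_zero] at h0
      omega
  · rintro h ⟨k, hk, hkn, hdec⟩
    have hle := h ⟨k - 1, by omega⟩
    have hge : n + 1 - k ≤ runMin p ⟨k - 1, by omega⟩ := by
      refine le_runMin fun a ha => ?_
      have ha' : (a : ℕ) < k := by have := Fin.le_def.mp ha; simp only at this; omega
      have hsub : ({j | (p a : ℕ) ≤ (p j : ℕ)} : Finset (Fin (n + 1))) ⊆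
          Iio ⟨k, hkn⟩ := by
        intro j hj
        simp only [mem_filter, mem_univ, true_and] at hj
        rw [mem_Iio, Fin.lt_def]
        by_contra! hjk
        have := Fin.lt_def.mp (hdec a j ha' hjk)
        omega
      have := Finset.card_le_card hsub
      rw [card_filter_le_perm, Fin.card_Iio] at this
      simp only at this
      omega
    simp only at hle
    omega

lemma image_runMin_AvStar (n : ℕ) :
    runMin '' AvStar pattern123 (n + 1) = staircaseSeq n n := by
  ext m
  constructor
  · rintro ⟨p, ⟨_, hp⟩, rfl⟩
    refine ⟨antitone_runMin p, fun i => ?_⟩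
    have := (indecomposable_iff_runMin_le p).mp hp i
    exact ⟨this, by omega⟩
  · rintro ⟨hm, h⟩
    obtain ⟨p, hp, rfl⟩ := exists_runMin_eq_of_antitone hm fun i => by
      have := (h i).1
      have := i.2
      omega
    exact ⟨p, ⟨hp, (indecomposable_iff_runMin_le p).mpr fun i => (h i).1⟩, rfl⟩

lemma ncard_AvStar_pattern123 (n : ℕ) : (AvStar pattern123 (n + 1)).ncard = catalan n := by
  rw [← ncard_staircaseSeq_self, ← image_runMin_AvStar,
    Set.InjOn.ncard_image (runMin_injOn.mono fun _ h => h.1)]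

end PermPattern

theorem mainTheorem8 (n : ℕ) (hn : 1 ≤ n) :
    ((PermPattern.AvStar PermPattern.pattern123 n).ncard : ℚ)
        = 1 / (n : ℚ) * ((2 * n - 2).choose (n - 1) : ℚ) ∧
      (PermPattern.AvStar PermPattern.pattern123 n).ncard = catalan (n - 1) := by
  obtain ⟨n, rfl⟩ := Nat.exists_eq_add_of_le' hn
  have h := PermPattern.ncard_AvStar_pattern123 n
  refine ⟨?_, h⟩
  have hc := succ_mul_catalan_eq_centralBinom n
  rw [Nat.centralBinom_eq_two_mul_choose] at hc
  rw [h, show 2 * (n + 1) - 2 = 2 * n by omega, Nat.add_sub_cancel, ← hc]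
  have : ((n : ℚ) + 1) ≠ 0 := by positivity
  push_cast
  field_simp
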